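/- Consider finitely many parallel paths $i\in\mathcal P$ with transmission rates $r_i>0$ and packet erasure probabilities $\epsilon_i\in[0,1]$. Coded packets are sent on one path $c\in\mathcal P$ only, with code rate $c_c\in[0,1)$. Put $$l_c=\frac1{1-c_c},\qquad \alpha_i=(l_c-1)\frac{r_i}{r_c},\qquad \lambda=\epsilon_c+\sum_{i\in\mathcal P}\alpha_i\epsilon_i .$$ Let the numbers $Y_{n,i}$ ($n,i\ge1$) of packets lost in slot $i$ of epoch $n$ be independent and Poisson distributed with mean $\lambda$. Let the time $X_n\in\{0,1,2,\dots\}\cup\{\infty\}$ between decode events be $X_n=0$ if $Y_{n,1}=0$, and otherwise $$X_n=\inf\Bigl\{z\ge1:\ \sum_{i=1}^{z}Y_{n,i}\le z\Bigr\}\qquad(\inf\emptyset=\infty).$$ Let $W_n=\max(X_n,1)$. Then for every $n$: 1. $P(W_n=0)=0$, $\;P(W_n=1)=(\lambda+1)e^{-\lambda}$, and for every integer $w\ge2$ $$P(W_n=w)=\frac{(w-1)^{w-2}}{w\,(w-2)!}\,\lambda^{w}e^{-w\lambda};$$ if $\lambda<1$, then moreover $P(W_n=\infty)=0$, so that this is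 the whole law of $W_n$. 2. If $\lambda>0$, then $\mathbb E[W_n]=\mathbb E[X_n]/\lambda$ as an identity in $[0,\infty]$. If $\lambda<1$, then $\mathbb E[X_n]$ and $\mathbb E[W_n]$ are finite. -/

import Mathlib

open MeasureTheory ProbabilityTheory
open scoped ENNReal Nat

/-- A finite family of parallel paths, indexed by `ι`.  Path `i` has transmission rate `rate i`
(packets per second) and packet erasure probability `erasure i`.  Coded packets are sent on the
single path `coded` only, whose code rate is `codeRate`. -/
structure CodedNetwork (ι : Type*) where
  /-- the path that carries the coded packets -/
  coded : ι
  /-- transmission rates -/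
  rate : ι → ℝ
  /-- packet erasure probabilities -/
  erasure : ι → ℝ
  /-- code rate on the path `coded` -/
  codeRate : ℝ
  rate_pos : ∀ i, 0 < rate i
  erasure_mem : ∀ i, erasure i ∈ Set.Icc (0 : ℝ) 1
  codeRate_nonneg : 0 ≤ codeRate
  codeRate_lt_one : codeRate < 1

namespace CodedNetwork

variable {ι : Type*}

/-- The number `l = 1 / (1 - c)` of packets sent on the coded path per coded packet. -/
noncomputable def period (N : CodedNetwork ι) : ℝ := 1 / (1 - N.codeRate)

/-- The number of information packets sent on path `i` per time slot, that is, per transmitted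
coded packet. -/
noncomputable def infoPackets (N : CodedNetwork ι) (i : ι) : ℝ :=
  (N.period - 1) * (N.rate i / N.rate N.coded)

/-- The expected number of packets lost, over all paths, in one time slot. -/
noncomputable def lossRate [Fintype ι] (N : CodedNetwork ι) : ℝ :=
  N.erasure N.coded + ∑ i, N.infoPackets i * N.erasure i

theorem lossRate_nonneg [Fintype ι] (N : CodedNetwork ι) : 0 ≤ N.lossRate := by
  have h1 : 0 ≤ N.period - 1 := by
    have h0 : 0 < 1 - N.codeRate := sub_pos.2 N.codeRate_lt_one
    rw [period, sub_nonneg, le_div_iff₀ h0]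
    linarith [N.codeRate_nonneg]
  refine add_nonneg (N.erasure_mem _).1 (Finset.sum_nonneg fun i _ => ?_)
  exact mul_nonneg (mul_nonneg h1 (div_nonneg (N.rate_pos _).le (N.rate_pos _).le))
    (N.erasure_mem i).1

end CodedNetwork

/-- The first time slot count `z ≥ 1` at which the number of packets lost in the first `z` slots is
at most `z`, the number of coded packets sent; `⊤` if there is no such `z`.  Here `y i` is the
number of packets lost in slot `i + 1`. -/
noncomputable def firstRenewal (y : ℕ → ℕ) : ℕ∞ :=
  sInf ((fun z : ℕ => (z : ℕ∞)) '' {z : ℕ | 1 ≤ z ∧ ∑ i ∈ Finset.range z, y i ≤ z})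

/-- The inter-arrival time between decode events, as a function of the numbers of lost packets in
the successive slots of an epoch: it is `0` if nothing is lost in the first slot, and the first
renewal time otherwise. -/
noncomputable def interArrival (y : ℕ → ℕ) : ℕ∞ :=
  if y 0 = 0 then 0 else firstRenewal y

/-- The inter-arrival time truncated below at one slot, `max (X, 1)`. -/
noncomputable def interArrivalOne (y : ℕ → ℕ) : ℕ∞ := max (interArrival y) 1

/-! ### Deterministic properties of the renewal time -/

theorem natCast_lt_firstRenewal_iff {y : ℕ → ℕ} {i : ℕ} :
    (i : ℕ∞) < firstRenewal y ↔ ∀ z, 1 ≤ z → z ≤ i → z < ∑ j ∈ Finset.range z, y j := by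
  rw [← not_le, ← not_iff_not, not_not]
  push Not
  constructor
  · intro h
    have hne : ((fun z : ℕ => (z : ℕ∞)) ''
        {z : ℕ | 1 ≤ z ∧ ∑ i ∈ Finset.range z, y i ≤ z}).Nonempty := by
      by_contra hempty
      rw [Set.not_nonempty_iff_eq_empty] at hempty
      rw [firstRenewal, hempty, sInf_empty, top_le_iff] at h
      exact ENat.natCast_ne_top i h
    obtain ⟨z, ⟨hz1, hz2⟩, hz⟩ := csInf_mem hne
    refine ⟨z, hz1, ?_, hz2⟩
    have hz' : (z : ℕ∞) = firstRenewal y := hz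
    rw [← hz'] at h
    exact_mod_cast h
  · rintro ⟨z, hz1, hzi, hz2⟩
    have h : firstRenewal y ≤ (z : ℕ∞) := sInf_le ⟨z, ⟨hz1, hz2⟩, rfl⟩
    exact h.trans (by exact_mod_cast hzi)

theorem firstRenewal_pos (y : ℕ → ℕ) : 0 < firstRenewal y := by
  have h : ((0 : ℕ) : ℕ∞) < firstRenewal y := natCast_lt_firstRenewal_iff.2 (by omega)
  exact_mod_cast h

theorem firstRenewal_eq_natCast_iff {y : ℕ → ℕ} {w : ℕ} (hw : 1 ≤ w) :
    firstRenewal y = w ↔ ∑ j ∈ Finset.range w, y j ≤ w ∧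
      ∀ z, 1 ≤ z → z < w → z < ∑ j ∈ Finset.range z, y j := by
  obtain ⟨v, rfl⟩ : ∃ v, w = v + 1 := ⟨w - 1, by omega⟩
  have h1 : firstRenewal y = ((v + 1 : ℕ) : ℕ∞) ↔
      ((v : ℕ) : ℕ∞) < firstRenewal y ∧ ¬ (((v + 1 : ℕ) : ℕ∞) < firstRenewal y) := by
    rw [not_lt, le_antisymm_iff, and_comm, Nat.cast_add, Nat.cast_one,
      Order.add_one_le_iff_of_not_isMax (by simp)]
  rw [h1, natCast_lt_firstRenewal_iff, natCast_lt_firstRenewal_iff]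
  push Not
  constructor
  · rintro ⟨ha, z, hz1, hz2, hz3⟩
    obtain rfl : z = v + 1 := by
      by_contra hne
      exact absurd (ha z hz1 (by omega)) (by omega)
    exact ⟨hz3, fun z hz hz' => ha z hz (by omega)⟩
  · rintro ⟨ha, hb⟩
    exact ⟨fun z hz hz' => hb z hz (by omega), v + 1, hw, le_rfl, ha⟩

theorem firstRenewal_eq_one_iff {y : ℕ → ℕ} : firstRenewal y = 1 ↔ y 0 ≤ 1 := by
  rw [← Nat.cast_one, firstRenewal_eq_natCast_iff le_rfl]
  simp only [Finset.sum_range_one, and_iff_left_iff_imp]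
  omega

theorem interArrivalOne_eq_firstRenewal (y : ℕ → ℕ) : interArrivalOne y = firstRenewal y := by
  rw [interArrivalOne, interArrival]
  split_ifs with h
  · rw [firstRenewal_eq_one_iff.2 (by omega)]; simp
  · exact max_eq_left (Order.one_le_iff_pos.2 (firstRenewal_pos y))

theorem interArrival_le_firstRenewal (y : ℕ → ℕ) : interArrival y ≤ firstRenewal y := by
  rw [← interArrivalOne_eq_firstRenewal]; exact le_max_left _ _

theorem firstRenewal_le_interArrival_add_one (y : ℕ → ℕ) :
    firstRenewal y ≤ interArrival y + 1 := by
  rw [← interArrivalOne_eq_firstRenewal]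
  exact max_le le_self_add le_add_self

theorem sum_range_of_firstRenewal_eq {y : ℕ → ℕ} {w : ℕ} (h : firstRenewal y = w) :
    ((∑ j ∈ Finset.range w, y j : ℕ) : ℕ∞) = interArrival y := by
  have hw : 1 ≤ w := by
    have := firstRenewal_pos y
    rw [h] at this
    exact_mod_cast this
  rw [firstRenewal_eq_natCast_iff hw] at h
  rw [interArrival]
  obtain ⟨h1, h2⟩ := h
  split_ifs with h0
  · have : w = 1 := by
      by_contra hne
      have := h2 1 le_rfl (by omega)
      simp [h0] at this
    subst this
    simp [h0]
  · rw [(firstRenewal_eq_natCast_iff hw).2 ⟨h1, h2⟩, Nat.cast_inj]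
    refine le_antisymm h1 ?_
    obtain ⟨v, rfl⟩ : ∃ v, w = v + 1 := ⟨w - 1, by omega⟩
    rcases Nat.eq_zero_or_pos v with rfl | hv
    · rw [Finset.sum_range_one]; omega
    · have := h2 v hv (by omega)
      rw [Finset.sum_range_succ]; omega

/-- A sequence sampled before its first renewal and set to zero from then on. -/
noncomputable def untilRenewal (f : ℕ → ℕ) (y : ℕ → ℕ) (i : ℕ) : ℝ≥0∞ :=
  open Classical in if (i : ℕ∞) < firstRenewal y then (f i : ℝ≥0∞) else 0

theorem tsum_untilRenewal_of_eq (f : ℕ → ℕ) {y : ℕ → ℕ} {w : ℕ} (h : firstRenewal y = w) :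
    ∑' i, untilRenewal f y i = ((∑ i ∈ Finset.range w, f i : ℕ) : ℝ≥0∞) := by
  have hz : ∀ i, untilRenewal f y i = if i ∈ Finset.range w then (f i : ℝ≥0∞) else 0 := by
    intro i
    simp only [untilRenewal, h, Nat.cast_lt, Finset.mem_range]
  rw [tsum_eq_sum (s := Finset.range w) (fun i hi => by rw [hz, if_neg hi]), Nat.cast_sum]
  exact Finset.sum_congr rfl fun i hi => by rw [hz, if_pos hi]

theorem tsum_untilRenewal_one (y : ℕ → ℕ) :
    ∑' i, untilRenewal (fun _ => 1) y i = (firstRenewal y : ℝ≥0∞) := by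
  rcases eq_or_ne (firstRenewal y) ⊤ with h | h
  · simp [untilRenewal, h]
  · obtain ⟨w, hw⟩ := ENat.ne_top_iff_exists.1 h
    rw [tsum_untilRenewal_of_eq _ hw.symm, ← hw]
    simp

theorem tsum_untilRenewal_self {y : ℕ → ℕ} (h : firstRenewal y ≠ ⊤) :
    ∑' i, untilRenewal y y i = (interArrival y : ℝ≥0∞) := by
  obtain ⟨w, hw⟩ := ENat.ne_top_iff_exists.1 h
  rw [tsum_untilRenewal_of_eq _ hw.symm, ← sum_range_of_firstRenewal_eq hw.symm,
    ENat.toENNReal_coe]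

theorem sum_untilRenewal_one_le (y : ℕ → ℕ) (n : ℕ) :
    ∑ i ∈ Finset.range n, untilRenewal (fun _ => 1) y i ≤
      ∑ i ∈ Finset.range n, untilRenewal y y i + 1 := by
  by_cases h : ((n : ℕ) : ℕ∞) < firstRenewal y
  · have hu : ∀ f : ℕ → ℕ, ∑ i ∈ Finset.range n, untilRenewal f y i =
        ((∑ i ∈ Finset.range n, f i : ℕ) : ℝ≥0∞) := by
      intro f
      rw [Nat.cast_sum]
      refine Finset.sum_congr rfl fun i hi => if_pos (lt_of_le_of_lt ?_ h)
      exact_mod_cast (Finset.mem_range.1 hi).le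
    rw [hu, hu]
    rw [natCast_lt_firstRenewal_iff] at h
    have : ∑ i ∈ Finset.range n, 1 ≤ ∑ i ∈ Finset.range n, y i + 1 := by
      rcases Nat.eq_zero_or_pos n with rfl | hn
      · simp
      · have := h n hn le_rfl
        simp only [Finset.sum_const, Finset.card_range, smul_eq_mul, mul_one]
        omega
    exact_mod_cast this
  · have htop : firstRenewal y ≠ ⊤ := fun ht => h (ht ▸ ENat.natCast_lt_top n)
    have hzero : ∀ i ∉ Finset.range n, untilRenewal y y i = 0 := by
      intro i hi
      refine if_neg fun hlt => h (lt_of_le_of_lt ?_ hlt)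
      exact_mod_cast not_lt.1 (Finset.mem_range.not.1 hi)
    rw [← tsum_eq_sum (L := .unconditional ℕ) hzero, tsum_untilRenewal_self htop]
    refine (ENNReal.sum_le_tsum _).trans ?_
    rw [tsum_untilRenewal_one]
    exact_mod_cast firstRenewal_le_interArrival_add_one y

/-! ### Events that depend on finitely many of the variables -/

section Renewal

variable {Ω : Type*} [MeasurableSpace Ω] {P : Measure Ω} {Z : ℕ → Ω → ℕ}

theorem measurable_of_dependsOn {β : Type*} [MeasurableSpace β]
    (hZ : ∀ i, Measurable (Z i)) {f : (ℕ → ℕ) → β} {S : Finset ℕ}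
    (hf : DependsOn f (S : Set ℕ)) : Measurable fun ω => f fun i => Z i ω := by
  have hfac : (fun ω => f fun i => Z i ω) =
      (fun x : S → ℕ => f fun i => if h : i ∈ S then x ⟨i, h⟩ else 0) ∘
        fun ω (i : S) => Z i ω := by
    funext ω
    exact hf fun i hi => by simp [Finset.mem_coe.1 hi]
  rw [hfac]
  exact Measurable.of_discrete.comp (measurable_pi_lambda _ fun i => hZ i)

theorem indepFun_of_dependsOn {β γ : Type*} [MeasurableSpace β] [MeasurableSpace γ]
    (hind : iIndepFun Z P) (hZ : ∀ i, Measurable (Z i)) {f : (ℕ → ℕ) → β} {g : (ℕ → ℕ) → γ}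
    {S T : Finset ℕ} (hST : Disjoint S T) (hf : DependsOn f (S : Set ℕ))
    (hg : DependsOn g (T : Set ℕ)) :
    IndepFun (fun ω => f fun i => Z i ω) (fun ω => g fun i => Z i ω) P := by
  have h := (hind.indepFun_finset S T hST hZ).comp
    (Measurable.of_discrete (f := fun x : S → ℕ => f fun i => if h : i ∈ S then x ⟨i, h⟩ else 0))
    (Measurable.of_discrete (f := fun x : T → ℕ => g fun i => if h : i ∈ T then x ⟨i, h⟩ else 0))
  convert h using 1
  · funext ω
    exact hf fun i hi => by simp [Finset.mem_coe.1 hi]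
  · funext ω
    exact hg fun i hi => by simp [Finset.mem_coe.1 hi]

/-! ### The mean of the renewal time -/

theorem dependsOn_natCast_lt_firstRenewal (i : ℕ) :
    DependsOn (fun y => (i : ℕ∞) < firstRenewal y) (Finset.range i : Set ℕ) := by
  intro x y hxy
  simp only [eq_iff_iff, natCast_lt_firstRenewal_iff]
  refine forall_congr' fun z => forall_congr' fun _ => forall_congr' fun hz => ?_
  rw [Finset.sum_congr rfl fun j hj => hxy j ?_]
  simp only [Finset.mem_range, Finset.coe_range, Set.mem_Iio] at hj ⊢
  omega

theorem measurable_untilRenewal_one (hZ : ∀ i, Measurable (Z i)) (i : ℕ) :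
    Measurable fun ω => untilRenewal (fun _ => 1) (fun j => Z j ω) i := by
  refine measurable_of_dependsOn hZ (S := Finset.range i)
    (f := fun y => untilRenewal (fun _ => 1) y i) fun x y hxy => ?_
  have h := dependsOn_natCast_lt_firstRenewal i hxy
  simp only [untilRenewal]
  simp only at h
  simp only [h]

theorem untilRenewal_self_eq_mul (y : ℕ → ℕ) (i : ℕ) :
    untilRenewal y y i = untilRenewal (fun _ => 1) y i * (y i : ℝ≥0∞) := by
  simp only [untilRenewal]
  split_ifs <;> simp

theorem measurable_untilRenewal_self (hZ : ∀ i, Measurable (Z i)) (i : ℕ) :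
    Measurable fun ω => untilRenewal (fun j => Z j ω) (fun j => Z j ω) i := by
  simp only [untilRenewal_self_eq_mul]
  exact (measurable_untilRenewal_one hZ i).mul (Measurable.of_discrete.comp (hZ i))

theorem lintegral_untilRenewal_self (hind : iIndepFun Z P) (hZ : ∀ i, Measurable (Z i)) (i : ℕ) :
    ∫⁻ ω, untilRenewal (fun j => Z j ω) (fun j => Z j ω) i ∂P =
      (∫⁻ ω, untilRenewal (fun _ => 1) (fun j => Z j ω) i ∂P) * ∫⁻ ω, (Z i ω : ℝ≥0∞) ∂P := by
  simp only [untilRenewal_self_eq_mul]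
  refine lintegral_mul_eq_lintegral_mul_lintegral_of_indepFun (measurable_untilRenewal_one hZ i)
    (Measurable.of_discrete.comp (hZ i)) ?_
  refine indepFun_of_dependsOn hind hZ (S := Finset.range i) (T := {i})
    (f := fun y => untilRenewal (fun _ => 1) y i) (g := fun y => (y i : ℝ≥0∞)) (by simp) ?_ ?_
  · intro x y hxy
    have h := dependsOn_natCast_lt_firstRenewal i hxy
    simp only at h
    simp only [untilRenewal, h]
  · intro x y hxy
    simp only [hxy i (by simp)]

theorem lintegral_natCast_poissonMeasure (r : NNReal) :
    ∫⁻ n, (n : ℝ≥0∞) ∂(poissonMeasure r) = r := by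
  have h := hasSum_one_poissonMeasure r
  rw [poissonMeasure, lintegral_sum_measure]
  simp only [lintegral_smul_measure, lintegral_dirac, smul_eq_mul]
  rw [tsum_eq_zero_add' ENNReal.summable]
  simp only [Nat.cast_zero, mul_zero, zero_add]
  have hterm : ∀ n : ℕ, ENNReal.ofReal (Real.exp (-r) * r ^ (n + 1) / ((n + 1)! : ℝ)) *
      ((n + 1 : ℕ) : ℝ≥0∞) = r * ENNReal.ofReal (Real.exp (-r) * r ^ n / (n ! : ℝ)) := by
    intro n
    rw [← ENNReal.ofReal_natCast, ← ENNReal.ofReal_mul (by positivity),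
      ← ENNReal.ofReal_coe_nnreal, ← ENNReal.ofReal_mul (by positivity), Nat.factorial_succ]
    congr 1
    push_cast
    field_simp
    ring
  simp only [hterm]
  rw [ENNReal.tsum_mul_left, ← ENNReal.ofReal_tsum_of_nonneg (fun n => by positivity) h.summable,
    h.tsum_eq]
  simp

/-- Wald's identity for the renewal time: the numbers lost before it, in the mean. -/
theorem lintegral_tsum_untilRenewal_self {μ : ℝ≥0∞} (hind : iIndepFun Z P)
    (hZ : ∀ i, Measurable (Z i)) (hmean : ∀ i, ∫⁻ ω, (Z i ω : ℝ≥0∞) ∂P = μ) :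
    ∫⁻ ω, ∑' i, untilRenewal (fun j => Z j ω) (fun j => Z j ω) i ∂P =
      (∫⁻ ω, (firstRenewal fun i => Z i ω : ℝ≥0∞) ∂P) * μ := by
  simp only [← tsum_untilRenewal_one]
  rw [lintegral_tsum fun i => (measurable_untilRenewal_self hZ i).aemeasurable,
    lintegral_tsum fun i => (measurable_untilRenewal_one hZ i).aemeasurable,
    ← ENNReal.tsum_mul_right]
  simp only [lintegral_untilRenewal_self hind hZ, hmean]

theorem lintegral_firstRenewal_le [IsProbabilityMeasure P] {μ : ℝ≥0∞}
    (hind : iIndepFun Z P) (hZ : ∀ i, Measurable (Z i))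
    (hmean : ∀ i, ∫⁻ ω, (Z i ω : ℝ≥0∞) ∂P = μ) :
    ∫⁻ ω, (firstRenewal fun i => Z i ω : ℝ≥0∞) ∂P ≤ (1 - μ)⁻¹ := by
  simp only [← tsum_untilRenewal_one]
  rw [lintegral_tsum fun i => (measurable_untilRenewal_one hZ i).aemeasurable]
  rw [ENNReal.tsum_eq_iSup_nat]
  refine iSup_le fun n => ?_
  set a := ∑ i ∈ Finset.range n, ∫⁻ ω, untilRenewal (fun _ => 1) (fun j => Z j ω) i ∂P with ha
  have hle : a ≤ a * μ + 1 := by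
    have h := lintegral_mono (μ := P) fun ω => sum_untilRenewal_one_le (fun j => Z j ω) n
    rw [lintegral_add_right _ measurable_const, lintegral_finsetSum _ fun i _ =>
      measurable_untilRenewal_one hZ i, lintegral_finsetSum _ fun i _ =>
      measurable_untilRenewal_self hZ i] at h
    simp only [lintegral_untilRenewal_self hind hZ, hmean] at h
    rwa [← Finset.sum_mul, lintegral_const, measure_univ, mul_one] at h
  have hfin : a ≠ ⊤ := by
    refine ENNReal.sum_ne_top.2 fun i _ => ?_
    refine ne_top_of_le_ne_top ENNReal.one_ne_top
      ((lintegral_mono (g := fun _ => 1) fun ω => ?_).trans (by simp))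
    simp only [untilRenewal]
    split_ifs <;> simp
  rw [ENNReal.le_inv_iff_mul_le, ENNReal.mul_sub fun _ _ => hfin, mul_one]
  exact tsub_le_iff_left.2 hle

theorem measurable_firstRenewal (hZ : ∀ i, Measurable (Z i)) :
    Measurable fun ω => (firstRenewal fun i => Z i ω : ℝ≥0∞) := by
  simp only [← tsum_untilRenewal_one]
  exact Measurable.tsum fun i => measurable_untilRenewal_one hZ i

theorem lintegral_interArrival {μ : ℝ≥0∞} (hμ : μ ≠ 0) (hind : iIndepFun Z P)
    (hZ : ∀ i, Measurable (Z i)) (hmean : ∀ i, ∫⁻ ω, (Z i ω : ℝ≥0∞) ∂P = μ)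
    [IsFiniteMeasure P] :
    ∫⁻ ω, (interArrival fun i => Z i ω : ℝ≥0∞) ∂P =
      (∫⁻ ω, (firstRenewal fun i => Z i ω : ℝ≥0∞) ∂P) * μ := by
  by_cases h : ∫⁻ ω, (firstRenewal fun i => Z i ω : ℝ≥0∞) ∂P = ⊤
  · rw [h, ENNReal.top_mul hμ]
    have hle : ∫⁻ ω, (firstRenewal fun i => Z i ω : ℝ≥0∞) ∂P ≤
        ∫⁻ ω, (interArrival fun i => Z i ω : ℝ≥0∞) ∂P + P Set.univ := by
      rw [← lintegral_one, ← lintegral_add_right _ measurable_const]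
      exact lintegral_mono fun ω =>
        (ENat.toENNReal_le.2 (firstRenewal_le_interArrival_add_one fun i => Z i ω)).trans_eq
          (by simp)
    rw [h, top_le_iff, ENNReal.add_eq_top] at hle
    exact hle.resolve_right (measure_ne_top P _)
  · rw [← lintegral_tsum_untilRenewal_self hind hZ hmean]
    refine lintegral_congr_ae ?_
    filter_upwards [ae_lt_top (measurable_firstRenewal hZ) h] with ω hω
    exact (tsum_untilRenewal_self (ENat.toENNReal_ne_top.1 hω.ne)).symm

/-! ### The law of the renewal time -/

theorem sum_pow_div_factorial (a b : ℝ) (j : ℕ) :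
    ∑ y ∈ Finset.range (j + 1), a ^ y / (y ! : ℝ) * (b ^ (j - y) / ((j - y)! : ℝ)) =
      (a + b) ^ j / (j ! : ℝ) := by
  rw [add_pow, Finset.sum_div]
  refine Finset.sum_congr rfl fun y hy => ?_
  have hyj : y ≤ j := Nat.lt_succ_iff.1 (Finset.mem_range.1 hy)
  rw [Nat.cast_choose ℝ hyj]
  have h1 : (j ! : ℝ) ≠ 0 := by positivity
  field_simp

theorem sum_mul_pow_div_factorial (a b : ℝ) (j : ℕ) :
    ∑ y ∈ Finset.range (j + 1), (y : ℝ) * (a ^ y / (y ! : ℝ) * (b ^ (j - y) / ((j - y)! : ℝ))) *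
      (a + b) = a * j * ((a + b) ^ j / (j ! : ℝ)) := by
  rcases j with _ | j
  · simp
  rw [← Finset.sum_mul, Finset.sum_range_succ']
  have hterm : ∀ y : ℕ, ((y + 1 : ℕ) : ℝ) * (a ^ (y + 1) / ((y + 1)! : ℝ) *
      (b ^ (j + 1 - (y + 1)) / ((j + 1 - (y + 1))! : ℝ))) =
      a * (a ^ y / (y ! : ℝ) * (b ^ (j - y) / ((j - y)! : ℝ))) := by
    intro y
    rw [Nat.add_sub_add_right, Nat.factorial_succ]
    push_cast
    field_simp
    ring
  rw [Finset.sum_congr rfl fun y _ => hterm y, ← Finset.mul_sum, sum_pow_div_factorial,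
    Nat.factorial_succ]
  push_cast
  field_simp
  ring

/-- The sequences for which the walk with steps `y i - 1` started at `k` is positive before time `m`
and vanishes at time `m`. -/
def FirstHit (m k : ℕ) (y : ℕ → ℕ) : Prop :=
  (∀ z < m, z < k + ∑ i ∈ Finset.range z, y i) ∧ k + ∑ i ∈ Finset.range m, y i = m

theorem firstHit_succ_succ_iff {m k : ℕ} {y : ℕ → ℕ} :
    FirstHit (m + 1) (k + 1) y ↔ FirstHit m (k + y 0) fun i => y (i + 1) := by
  simp only [FirstHit, Finset.sum_range_succ' y]
  constructor
  · rintro ⟨h1, h2⟩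
    refine ⟨fun z hz => ?_, by omega⟩
    have := h1 (z + 1) (by omega)
    rw [Finset.sum_range_succ'] at this
    omega
  · rintro ⟨h1, h2⟩
    refine ⟨fun z hz => ?_, by omega⟩
    rcases z with _ | z
    · omega
    · have := h1 z (by omega)
      rw [Finset.sum_range_succ']
      omega

theorem FirstHit.le {m k : ℕ} {y : ℕ → ℕ} (h : FirstHit m k y) : k ≤ m := by
  have := h.2
  omega

theorem firstRenewal_eq_add_two_iff {m : ℕ} {y : ℕ → ℕ} :
    firstRenewal y = ((m + 2 : ℕ) : ℕ∞) ↔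
      2 ≤ y 0 ∧ FirstHit (m + 1) (y 0 - 1) fun i => y (i + 1) := by
  rw [firstRenewal_eq_natCast_iff (by omega)]
  simp only [FirstHit]
  constructor
  · rintro ⟨h1, h2⟩
    have h0 := h2 1 le_rfl (by omega)
    rw [Finset.sum_range_one] at h0
    have hl := h2 (m + 1) (by omega) (by omega)
    have hlt : ∑ j ∈ Finset.range (m + 1), y j ≤ ∑ j ∈ Finset.range (m + 2), y j :=
      Finset.sum_le_sum_of_subset (Finset.range_mono (by omega))
    rw [Finset.sum_range_succ' y (m + 1)] at h1 hlt
    refine ⟨h0, fun z hz => ?_, by omega⟩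
    have := h2 (z + 1) (by omega) (by omega)
    rw [Finset.sum_range_succ'] at this
    omega
  · rintro ⟨h0, h1, h2⟩
    rw [Finset.sum_range_succ' y (m + 1)]
    refine ⟨by omega, fun z hz hz' => ?_⟩
    obtain ⟨z, rfl⟩ : ∃ v, z = v + 1 := ⟨z - 1, by omega⟩
    have := h1 z (by omega)
    rw [Finset.sum_range_succ']
    omega

theorem dependsOn_firstHit_shift (m k s : ℕ) :
    DependsOn (fun y : ℕ → ℕ => FirstHit m k fun i => y (s + i))
      (Finset.Ico s (s + m) : Set ℕ) := by
  intro x y hxy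
  have hsum : ∀ z ≤ m, ∑ i ∈ Finset.range z, x (s + i) = ∑ i ∈ Finset.range z, y (s + i) := by
    intro z hz
    refine Finset.sum_congr rfl fun i hi => hxy _ ?_
    simp only [Finset.mem_range, Finset.coe_Ico, Set.mem_Ico] at hi ⊢
    omega
  simp only [FirstHit, hsum m le_rfl, eq_iff_iff]
  refine and_congr_left' (forall_congr' fun z => forall_congr' fun hz => ?_)
  rw [hsum z hz.le]

theorem measurableSet_firstHit_shift (hZ : ∀ i, Measurable (Z i)) (m k s : ℕ) :
    MeasurableSet {ω | FirstHit m k fun i => Z (s + i) ω} := by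
  simpa [Set.preimage] using
    measurable_of_dependsOn hZ (dependsOn_firstHit_shift m k s) (measurableSet_singleton True)

theorem measureReal_eq_inter_firstHit_shift (hind : iIndepFun Z P) (hZ : ∀ i, Measurable (Z i))
    (m k s y : ℕ) :
    P.real ({ω | Z s ω = y} ∩ {ω | FirstHit m k fun i => Z (s + 1 + i) ω}) =
      P.real {ω | Z s ω = y} * P.real {ω | FirstHit m k fun i => Z (s + 1 + i) ω} := by
  have h := indepFun_of_dependsOn hind hZ (S := {s}) (T := Finset.Ico (s + 1) (s + 1 + m))
    (f := fun x => x s) (by simp) (fun x x' h => h s (by simp))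
    (dependsOn_firstHit_shift m k (s + 1))
  have h' := h.measure_inter_preimage_eq_mul {y} {True} (measurableSet_singleton _)
    (measurableSet_singleton _)
  simp only [Set.preimage, Set.mem_singleton_iff, eq_iff_iff, iff_true] at h'
  simp only [measureReal_def, h', ENNReal.toReal_mul]

theorem measureReal_eq_sum_inter [IsFiniteMeasure P] {f : Ω → ℕ} (hf : Measurable f) {n : ℕ}
    {E : Set Ω} {F : ℕ → Set Ω} (hF : ∀ y, MeasurableSet (F y))
    (h : ∀ ω, ω ∈ E ↔ ∃ y < n, f ω = y ∧ ω ∈ F y) :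
    P.real E = ∑ y ∈ Finset.range n, P.real ({ω | f ω = y} ∩ F y) := by
  have hE : E = ⋃ y ∈ Finset.range n, ({ω | f ω = y} ∩ F y) := by
    ext ω
    simp [h]
  rw [hE, measureReal_biUnion_finset]
  · intro y _ y' _ hne
    refine Set.disjoint_left.2 fun ω hω hω' => hne ?_
    exact hω.1.symm.trans hω'.1
  · exact fun y _ => (hf (measurableSet_singleton y)).inter (hF y)

/-- Hitting probability of a left-continuous walk with Poisson steps (Kemperman's formula). -/
theorem measureReal_firstHit [IsProbabilityMeasure P] {l : ℝ} (hind : iIndepFun Z P)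
    (hZ : ∀ i, Measurable (Z i))
    (hlaw : ∀ i y, P.real {ω | Z i ω = y} = Real.exp (-l) * l ^ y / (y ! : ℝ)) (m k s : ℕ) :
    P.real {ω | FirstHit (m + 1) k fun i => Z (s + i) ω} =
      if k ≤ m + 1 then (k : ℝ) / ((m : ℝ) + 1) * (Real.exp (-(((m : ℝ) + 1) * l)) *
        ((((m : ℝ) + 1) * l) ^ (m + 1 - k) / ((m + 1 - k)! : ℝ))) else 0 := by
  rcases k with _ | k
  · have : {ω | FirstHit (m + 1) 0 fun i => Z (s + i) ω} = ∅ :=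
      Set.eq_empty_of_forall_notMem fun ω hω => by simpa using hω.1 0 (by omega)
    rw [this]
    simp
  by_cases hk : k + 1 ≤ m + 1
  swap
  · rw [if_neg hk]
    have : {ω | FirstHit (m + 1) (k + 1) fun i => Z (s + i) ω} = ∅ :=
      Set.eq_empty_of_forall_notMem fun ω hω => hk (FirstHit.le hω)
    rw [this, measureReal_empty]
  rw [if_pos hk]
  induction m generalizing k s with
  | zero =>
    obtain rfl : k = 0 := by omega
    have : {ω | FirstHit (0 + 1) (0 + 1) fun i => Z (s + i) ω} = {ω | Z s ω = 0} := by
      ext ω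
      simp [FirstHit]
    rw [this, hlaw]
    simp
  | succ m ih =>
    obtain ⟨j, hj⟩ : ∃ j, m + 1 = k + j := ⟨m + 1 - k, by omega⟩
    have hsplit : P.real {ω | FirstHit (m + 1 + 1) (k + 1) fun i => Z (s + i) ω} =
        ∑ y ∈ Finset.range (j + 1), P.real ({ω | Z s ω = y} ∩
          {ω | FirstHit (m + 1) (k + y) fun i => Z (s + 1 + i) ω}) := by
      refine measureReal_eq_sum_inter (hZ s)
        (fun y => measurableSet_firstHit_shift hZ (m + 1) (k + y) (s + 1)) fun ω => ?_
      have hs : (fun i => Z (s + (i + 1)) ω) = fun i => Z (s + 1 + i) ω := by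
        funext i
        rw [add_comm i 1, add_assoc]
      simp only [Set.mem_ofPred_eq]
      rw [firstHit_succ_succ_iff, hs, add_zero]
      constructor
      · intro h
        exact ⟨Z s ω, by have := h.le; omega, rfl, h⟩
      · rintro ⟨y, -, rfl, h⟩
        exact h
    have hterm : ∀ y ∈ Finset.range (j + 1), P.real ({ω | Z s ω = y} ∩
        {ω | FirstHit (m + 1) (k + y) fun i => Z (s + 1 + i) ω}) =
        Real.exp (-l) * Real.exp (-(((m : ℝ) + 1) * l)) / ((m : ℝ) + 1) *
          (k * (l ^ y / (y ! : ℝ) * ((((m : ℝ) + 1) * l) ^ (j - y) / ((j - y)! : ℝ))) +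
          y * (l ^ y / (y ! : ℝ) * ((((m : ℝ) + 1) * l) ^ (j - y) / ((j - y)! : ℝ)))) := by
      intro y hy
      have hyj : y ≤ j := Nat.lt_succ_iff.1 (Finset.mem_range.1 hy)
      rw [measureReal_eq_inter_firstHit_shift hind hZ, hlaw]
      have hval : P.real {ω | FirstHit (m + 1) (k + y) fun i => Z (s + 1 + i) ω} =
          ((k + y : ℕ) : ℝ) / ((m : ℝ) + 1) * (Real.exp (-(((m : ℝ) + 1) * l)) *
            ((((m : ℝ) + 1) * l) ^ (j - y) / ((j - y)! : ℝ))) := by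
        rcases Nat.eq_zero_or_pos (k + y) with h0 | h0
        · rw [h0]
          have : {ω | FirstHit (m + 1) 0 fun i => Z (s + 1 + i) ω} = ∅ :=
            Set.eq_empty_of_forall_notMem fun ω hω => by simpa using hω.1 0 (by omega)
          rw [this]
          simp
        · obtain ⟨k', hk'⟩ : ∃ k', k + y = k' + 1 := ⟨k + y - 1, by omega⟩
          rw [hk', ih (s + 1) k' (by omega), show m + 1 - (k' + 1) = j - y by omega]
      rw [hval]
      push_cast
      ring
    rw [hsplit, Finset.sum_congr rfl hterm, ← Finset.mul_sum, Finset.sum_add_distrib,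
      ← Finset.mul_sum, sum_pow_div_factorial, show m + 1 + 1 - (k + 1) = j by omega, ← Real.exp_add]
    have hB := sum_mul_pow_div_factorial l (((m : ℝ) + 1) * l) j
    rw [← Finset.sum_mul] at hB
    have hjm : (j : ℝ) = m + 1 - k := by
      have : ((m + 1 : ℕ) : ℝ) = ((k + j : ℕ) : ℝ) := by rw [hj]
      push_cast at this
      linarith
    rw [show l + ((m : ℝ) + 1) * l = ((m : ℝ) + 1 + 1) * l by ring] at hB ⊢
    set B := ∑ y ∈ Finset.range (j + 1), (y : ℝ) * (l ^ y / (y ! : ℝ) *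
      ((((m : ℝ) + 1) * l) ^ (j - y) / ((j - y)! : ℝ)))
    push_cast
    rw [show -l + -(((m : ℝ) + 1) * l) = -(((m : ℝ) + 1 + 1) * l) by ring]
    rcases eq_or_ne l 0 with rfl | hl
    · have hB0 : B = 0 := by
        refine Finset.sum_eq_zero fun y _ => ?_
        rcases y with _ | y <;> simp
      rw [hB0]
      rcases j with _ | j
      · have : (k : ℝ) = m + 1 := by simp at hjm; linarith
        simp [this]
        field_simp
      · simp
    · have hB' : B = j / ((m : ℝ) + 1 + 1) * ((((m : ℝ) + 1 + 1) * l) ^ j / (j ! : ℝ)) := by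
        have h2 : ((m : ℝ) + 1 + 1) ≠ 0 := by positivity
        field_simp at hB ⊢
        linarith
      rw [hB', hjm]
      have h1 : ((m : ℝ) + 1) ≠ 0 := by positivity
      have h2 : ((m : ℝ) + 1 + 1) ≠ 0 := by positivity
      field_simp
      ring

theorem measureReal_firstRenewal_eq_add_two [IsProbabilityMeasure P] {l : ℝ}
    (hind : iIndepFun Z P) (hZ : ∀ i, Measurable (Z i))
    (hlaw : ∀ i y, P.real {ω | Z i ω = y} = Real.exp (-l) * l ^ y / (y ! : ℝ)) (m : ℕ) :
    P.real {ω | firstRenewal (fun i => Z i ω) = ((m + 2 : ℕ) : ℕ∞)} =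
      ((m : ℝ) + 1) ^ m / (((m : ℝ) + 2) * (m ! : ℝ)) * l ^ (m + 2) *
        Real.exp (-(((m : ℝ) + 2) * l)) := by
  have hsplit : P.real {ω | firstRenewal (fun i => Z i ω) = ((m + 2 : ℕ) : ℕ∞)} =
      ∑ y ∈ Finset.range (m + 3), P.real ({ω | Z 0 ω = y} ∩
        {ω | 2 ≤ y ∧ FirstHit (m + 1) (y - 1) fun i => Z (0 + 1 + i) ω}) := by
    refine measureReal_eq_sum_inter (hZ 0) (fun y => ?_) fun ω => ?_
    · rw [Set.ofPred_and]
      exact (MeasurableSet.const _).inter (measurableSet_firstHit_shift hZ (m + 1) (y - 1) (0 + 1))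
    simp only [Set.mem_ofPred_eq, firstRenewal_eq_add_two_iff,
      show ∀ i, 0 + 1 + i = i + 1 by omega]
    constructor
    · intro h
      exact ⟨Z 0 ω, by have := h.2.le; omega, rfl, h⟩
    · rintro ⟨y, -, rfl, h⟩
      exact h
  set a := ((m : ℝ) + 1) * l with ha
  have hterm : ∀ y ∈ Finset.range (m + 3), P.real ({ω | Z 0 ω = y} ∩
      {ω | 2 ≤ y ∧ FirstHit (m + 1) (y - 1) fun i => Z (0 + 1 + i) ω}) =
      Real.exp (-l) * Real.exp (-a) / ((m : ℝ) + 1) *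
        (y * (l ^ y / (y ! : ℝ) * (a ^ (m + 2 - y) / ((m + 2 - y)! : ℝ))) -
        l ^ y / (y ! : ℝ) * (a ^ (m + 2 - y) / ((m + 2 - y)! : ℝ)) +
        if y = 0 then a ^ (m + 2) / ((m + 2)! : ℝ) else 0) := by
    intro y hy
    have hym : y < m + 3 := Finset.mem_range.1 hy
    rcases y with _ | _ | y
    · simp
    · simp
    · have hset : {ω | 2 ≤ y + 1 + 1 ∧ FirstHit (m + 1) (y + 1 + 1 - 1) fun i => Z (0 + 1 + i) ω} =
          {ω | FirstHit (m + 1) (y + 1) fun i => Z (0 + 1 + i) ω} := by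
        ext ω
        simp
      rw [hset, measureReal_eq_inter_firstHit_shift hind hZ, hlaw,
        measureReal_firstHit hind hZ hlaw, if_pos (by omega), if_neg (by omega),
        show m + 2 - (y + 1 + 1) = m + 1 - (y + 1) by omega]
      push_cast
      ring
  rw [hsplit, Finset.sum_congr rfl hterm, ← Finset.mul_sum, Finset.sum_add_distrib,
    Finset.sum_sub_distrib, sum_pow_div_factorial l a (m + 2), Finset.sum_ite_eq',
    if_pos (by simp), ← Real.exp_add]
  have hB := sum_mul_pow_div_factorial l a (m + 2)
  rw [← Finset.sum_mul] at hB
  have hla : l + a = ((m : ℝ) + 2) * l := by rw [ha]; ring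
  rw [← neg_add, hla]
  rw [hla] at hB
  set B := ∑ y ∈ Finset.range (m + 2 + 1), (y : ℝ) * (l ^ y / (y ! : ℝ) *
    (a ^ (m + 2 - y) / ((m + 2 - y)! : ℝ)))
  rcases eq_or_ne l 0 with rfl | hl
  · have hB0 : B = 0 := by
      refine Finset.sum_eq_zero fun y _ => ?_
      rcases y with _ | y <;> simp
    rw [hB0]
    simp [ha]
  · have hB' : B = (((m : ℝ) + 2) * l) ^ (m + 2) / ((m + 2)! : ℝ) := by
      have h2 : ((m : ℝ) + 2) * l ≠ 0 := by positivity
      refine mul_right_cancel₀ h2 ?_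
      rw [hB]
      push_cast
      ring
    rw [hB', sub_self, zero_add, ha, mul_pow, Nat.factorial_succ, Nat.factorial_succ]
    push_cast
    field_simp
    ring

end Renewal

theorem mainTheorem5 {ι : Type*} [Fintype ι] (N : CodedNetwork ι)
    {Ω : Type*} [MeasurableSpace Ω] (P : Measure Ω) [IsProbabilityMeasure P]
    -- `Y n i` is the number of packets lost in slot `i + 1` of the epoch number `n + 1`
    (Y : ℕ → ℕ → Ω → ℕ)
    (hlaw : ∀ n i, HasLaw (Y n i) (poissonMeasure N.lossRate.toNNReal) P)
    (hindep : iIndepFun (fun p : ℕ × ℕ => Y p.1 p.2) P)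
    (X W : ℕ → Ω → ℕ∞)
    (hX : ∀ n ω, X n ω = interArrival (fun i => Y n i ω))
    (hW : ∀ n ω, W n ω = interArrivalOne (fun i => Y n i ω)) (n : ℕ) :
    -- the law of `W n`
    P {ω | W n ω = 0} = 0 ∧
    P {ω | W n ω = 1} = ENNReal.ofReal ((N.lossRate + 1) * Real.exp (-N.lossRate)) ∧
    (∀ w : ℕ, 2 ≤ w →
      P {ω | W n ω = (w : ℕ∞)} =
        ENNReal.ofReal (((w : ℝ) - 1) ^ (w - 2) / ((w : ℝ) * ((w - 2)! : ℝ)) *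
          N.lossRate ^ w * Real.exp (-((w : ℝ) * N.lossRate)))) ∧
    (N.lossRate < 1 → P {ω | W n ω = ⊤} = 0) ∧
    -- the mean of `W n`, as an identity in `[0, ∞]`, finite when the loss rate is below one
    (0 < N.lossRate →
      ∫⁻ ω, ((W n ω : ℕ∞) : ℝ≥0∞) ∂P =
        (∫⁻ ω, ((X n ω : ℕ∞) : ℝ≥0∞) ∂P) / ENNReal.ofReal N.lossRate) ∧
    (N.lossRate < 1 →
      ∫⁻ ω, ((X n ω : ℕ∞) : ℝ≥0∞) ∂P ≠ ⊤ ∧ ∫⁻ ω, ((W n ω : ℕ∞) : ℝ≥0∞) ∂P ≠ ⊤) := by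
  have hWF : ∀ ω, W n ω = firstRenewal fun i => Y n i ω := fun ω => by
    rw [hW, interArrivalOne_eq_firstRenewal]
  have hr0 : 0 ≤ N.lossRate := N.lossRate_nonneg
  set l := N.lossRate
  -- replace the variables of the epoch by measurable versions
  have haem : ∀ i, AEMeasurable (Y n i) P := fun i => (hlaw n i).aemeasurable
  set Z : ℕ → Ω → ℕ := fun i => (haem i).mk (Y n i) with hZdef
  have hZ : ∀ i, Measurable (Z i) := fun i => (haem i).measurable_mk
  have hYZ : ∀ i, Y n i =ᵐ[P] Z i := fun i => (haem i).ae_eq_mk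
  have hind : iIndepFun Z P :=
    (hindep.precomp (g := fun i : ℕ => (n, i)) (Prod.mk_right_injective n)).congr hYZ
  have hlawZ : ∀ i, HasLaw (Z i) (poissonMeasure l.toNNReal) P := fun i =>
    (hlaw n i).congr (hYZ i).symm
  have hall : ∀ᵐ ω ∂P, (fun i => Y n i ω) = fun i => Z i ω := by
    filter_upwards [ae_all_iff.2 hYZ] with ω hω
    exact funext hω
  have hWae : ∀ᵐ ω ∂P, W n ω = firstRenewal fun i => Z i ω := by
    filter_upwards [hall] with ω hω
    rw [hWF, hω]
  have hXae : ∀ᵐ ω ∂P, X n ω = interArrival fun i => Z i ω := by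
    filter_upwards [hall] with ω hω
    rw [hX, hω]
  have hPW : ∀ v : ℕ∞, P {ω | W n ω = v} = P {ω | firstRenewal (fun i => Z i ω) = v} := by
    intro v
    refine measure_congr ?_
    filter_upwards [hWae] with ω hω
    exact congrArg (· = v) hω
  have hintW : ∫⁻ ω, ((W n ω : ℕ∞) : ℝ≥0∞) ∂P =
      ∫⁻ ω, (firstRenewal fun i => Z i ω : ℝ≥0∞) ∂P :=
    lintegral_congr_ae (hWae.mono fun ω hω => congrArg ENat.toENNReal hω)
  have hintX : ∫⁻ ω, ((X n ω : ℕ∞) : ℝ≥0∞) ∂P =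
      ∫⁻ ω, (interArrival fun i => Z i ω : ℝ≥0∞) ∂P :=
    lintegral_congr_ae (hXae.mono fun ω hω => congrArg ENat.toENNReal hω)
  have hpmf : ∀ i y, P.real {ω | Z i ω = y} = Real.exp (-l) * l ^ y / (y ! : ℝ) := by
    intro i y
    have h := (hlawZ i).measureReal_eq (p := fun x => x = y) (measurableSet_singleton y)
    rw [h, Set.ofPred_eq_eq_singleton, poissonMeasure_real_singleton, Real.coe_toNNReal _ hr0]
  have hmean : ∀ i, ∫⁻ ω, (Z i ω : ℝ≥0∞) ∂P = ENNReal.ofReal l := by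
    intro i
    rw [← lintegral_map (f := fun k : ℕ => (k : ℝ≥0∞)) Measurable.of_discrete (hZ i),
      (hlawZ i).map_eq, lintegral_natCast_poissonMeasure]
    rfl
  have hfinW : l < 1 → ∫⁻ ω, (firstRenewal fun i => Z i ω : ℝ≥0∞) ∂P ≠ ⊤ := by
    intro hl
    refine ne_top_of_le_ne_top ?_ (lintegral_firstRenewal_le hind hZ hmean)
    rw [ENNReal.inv_ne_top, Ne, tsub_eq_zero_iff_le, not_le, ENNReal.ofReal_lt_one]
    exact hl
  refine ⟨?_, ?_, fun w hw => ?_, fun hl => ?_, fun hl => ?_, fun hl => ?_⟩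
  · rw [hPW]
    simp [(firstRenewal_pos _).ne']
  · rw [hPW, ← ofReal_measureReal]
    congr 1
    have h := measureReal_eq_sum_inter (P := P) (hZ 0) (n := 2)
      (E := {ω | firstRenewal (fun i => Z i ω) = 1}) (F := fun _ => Set.univ)
      (fun _ => MeasurableSet.univ) (fun ω => by
        simp only [Set.mem_ofPred_eq, firstRenewal_eq_one_iff, Set.mem_univ, and_true,
          exists_eq_right']
        omega)
    rw [h, Finset.sum_range_succ, Finset.sum_range_one, Set.inter_univ, Set.inter_univ, hpmf, hpmf]
    simp
    ring
  · obtain ⟨m, rfl⟩ : ∃ m, w = m + 2 := ⟨w - 2, by omega⟩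
    rw [hPW, ← ofReal_measureReal, measureReal_firstRenewal_eq_add_two hind hZ hpmf,
      Nat.add_sub_cancel]
    push_cast
    rw [show (m : ℝ) + 2 - 1 = m + 1 by ring]
  · rw [hPW]
    have h := ae_lt_top (measurable_firstRenewal hZ) (hfinW hl)
    rw [ae_iff] at h
    simpa using h
  · have hl0 : ENNReal.ofReal l ≠ 0 := (ENNReal.ofReal_pos.2 hl).ne'
    rw [hintW, hintX, lintegral_interArrival hl0 hind hZ hmean,
      ENNReal.mul_div_cancel_right hl0 ENNReal.ofReal_ne_top]
  · rw [hintW, hintX]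
    exact ⟨ne_top_of_le_ne_top (hfinW hl) (lintegral_mono fun ω =>
      ENat.toENNReal_le.2 (interArrival_le_firstRenewal _)), hfinW hl⟩
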